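/- Let $G=(V,E)$ be a directed graph (self-loops allowed) on a nonempty finite set $V$ of $K$ actions; write $N^{\mathrm{in}}(v)=\{w:(w,v)\in E\}$ and $N^{\mathrm{out}}(v)=\{w:(v,w)\in E\}$. A vertex $v$ is observable if $N^{\mathrm{in}}(v)\neq\emptyset$, strongly-observable if $v\in N^{\mathrm{in}}(v)$ or $V\setminus\{v\}\subseteq N^{\mathrm{in}}(v)$, and weakly-observable if it is observable but not strongly-observable. $G$ is strongly-observable if all its vertices are, and weakly-observable if all its vertices are observable but not all are strongly-observable. A set $U\subseteq V$ is weakly dominating if every weakly-observable vertex lies in $N^{\mathrm{out}}(d)$ for some $d\in U$. Let $\alpha$ be the independence number of $G$ (the largest size of a set of vertices no two distinct members of which are joined by an edge). An adversary with memory of size $m$ is a sequence of functions $f_t:V^t\to[0,1]$ such that $f_t(x_1,\dots,x_t)$ depends only on the last $m+1$ arguments. The policy regret of a play $X_1,\dots,X_T$ is $R_T=\sum_{t=1}^T f_t(X_1,\dots,X_t)-\min_{x\in V}\sum_{t=1}^T f_t(x,\dots,x)$. Exp3.G with learning rate $\eta$, exploration rate $\gamma$ and exploration set $U\subseteq V$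 starts from the uniform distribution $q_1$ on $V$. In round $j$ it draws $Z_j\sim p_j=(1-\gamma)q_j+\gamma u$, with $u$ uniform on $U$, observes $\ell_j(i)$ for $i\in N^{\mathrm{out}}(Z_j)$, puts $\widehat\ell_j(i)=\ell_j(i)\,\mathbf 1\{i\in N^{\mathrm{out}}(Z_j)\}/\sum_{k\in N^{\mathrm{in}}(i)}p_j(k)$, and updates $q_{j+1}(i)\propto q_j(i)\exp(-\eta\widehat\ell_j(i))$. Mini-batched Exp3.G with batch size $\tau>m$ and horizon $T$ runs Exp3.G for $J=\lfloor T/\tau\rfloor$ rounds. The action $Z_j$ is played in the $\tau$ game rounds $(j-1)\tau+1,\dots,j\tau$, and the loss function of the $j$-th round of Exp3.G is the average loss over the batch, $\ell_j(i)=\frac1\tau\sum_{t=(j-1)\tau+1}^{j\tau}f_t(X_1,\dots,X_{(j-1)\tau},i,\dots,i)$, revealed for $i\in N^{\mathrm{out}}(Z_j)$. In each of the remaining rounds $J\tau+1,\dots,T$ the action is drawn afresh from the current distribution $p_{J+1}$ of Exp3.G. Theorem. Fix $G$, $m\ge 0$ and batch sizes $\tau=\tau_T>m$. (1) If $G$ is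 strongly-observable, $\tau_T=\Theta(T^{1/3})$, and $U=V$, $\gamma=\min\{(1/(\alpha J))^{1/2},1/2\}$, $\eta=\gamma/2$, then mini-batched Exp3.G has policy regret $\mathbb E[R_T]=\widetilde{\mathcal O}(T^{2/3})$. (2) Let $G$ be weakly-observable and $\tau_T=\Theta(T^{1/4})$. There are weakly dominating sets $U$ that do not consist of a single vertex without a self-loop, and for each of them, with $\gamma=\min\{(|U|\ln K/J)^{1/3},1/2\}$ and $\eta=\gamma^2/|U|$, mini-batched Exp3.G with exploration set $U$ has policy regret $\mathbb E[R_T]=\widetilde{\mathcal O}(T^{3/4})$. Here $\mathbb E[R_T]=\widetilde{\mathcal O}(T^a)$ means that there are constants $C$ and $k$, depending only on $G$, $m$, the batch sizes $(\tau_T)_T$ and, in (2), on $U$, with $\mathbb E[R_T]\le C\,T^a(\ln T)^k$ for all $T\ge2$ and every adversary with memory of size $m$; the expectation is over the draws of the algorithm. -/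

import Mathlib

open Filter Asymptotics
open scoped BigOperators Topology

namespace FeedbackGame

noncomputable section

/-! ## Feedback graphs

A feedback graph is a directed graph, self-loops allowed, on the finite set `V` of actions.
An edge `G.Adj i j` means that playing `i` reveals the loss of `j`. -/

section Graphs

variable {V : Type*} [Fintype V]

open Classical in
/-- The in-neighbourhood `N^in(v) = {w : (w, v) ∈ E}`. -/
def inNbhd (G : Digraph V) (v : V) : Finset V :=
  Finset.univ.filter fun w => G.Adj w v

open Classical in
/-- The out-neighbourhood `N^out(v) = {w : (v, w) ∈ E}`. -/
def outNbhd (G : Digraph V) (v : V) : Finset V :=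
  Finset.univ.filter fun w => G.Adj v w

/-- The vertex `v` is observable. -/
def ObservableAt (G : Digraph V) (v : V) : Prop :=
  (inNbhd G v).Nonempty

open Classical in
/-- The vertex `v` is strongly-observable: `{v} ⊆ N^in(v)` or `V \ {v} ⊆ N^in(v)`, or both. -/
def StronglyObservableAt (G : Digraph V) (v : V) : Prop :=
  {v} ⊆ inNbhd G v ∨ Finset.univ \ {v} ⊆ inNbhd G v

/-- The vertex `v` is weakly-observable: observable, but not strongly. -/
def WeaklyObservableAt (G : Digraph V) (v : V) : Prop :=
  ObservableAt G v ∧ ¬ StronglyObservableAt G v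

/-- All vertices are observable. -/
def Observable (G : Digraph V) : Prop :=
  ∀ v, ObservableAt G v

/-- All vertices are strongly-observable. -/
def StronglyObservable (G : Digraph V) : Prop :=
  ∀ v, StronglyObservableAt G v

/-- The graph is observable, but not strongly. -/
def WeaklyObservable (G : Digraph V) : Prop :=
  Observable G ∧ ¬ StronglyObservable G

/-- Every weakly-observable vertex is an out-neighbour of some vertex of `D`. -/
def WeaklyDominating (G : Digraph V) (D : Finset V) : Prop :=
  ∀ v, WeaklyObservableAt G v → ∃ d ∈ D, v ∈ outNbhd G d

/-- No edge, in either direction, joins two distinct vertices of `S`. -/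
def Independent (G : Digraph V) (S : Finset V) : Prop :=
  ∀ u ∈ S, ∀ v ∈ S, u ≠ v → ¬ G.Adj u v

open Classical in
/-- The independence number: the largest cardinality of an independent set. -/
def independenceNumber (G : Digraph V) : ℕ :=
  (Finset.univ.filter fun S : Finset V => Independent G S).sup Finset.card

end Graphs

/-! ## Adversaries -/

section Adversaries

variable {V : Type*}

/-- A sequence of nonoblivious loss functions: `f t` is a function of the `t` actions
of the rounds `1, …, t` (the action of round `s + 1` is coordinate `s`);
`f 0` plays no role. -/
abbrev LossSeq (V : Type*) := (t : ℕ) → (Fin t → V) → ℝ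

/-- All losses lie in `[0, 1]`. -/
def UnitLosses (f : LossSeq V) : Prop :=
  ∀ t x, f t x ∈ Set.Icc (0 : ℝ) 1

/-- The adversary has memory of size `m`: the loss of round `t` depends only on the
`m + 1` most recent actions, those of the rounds `t - m, …, t`. -/
def HasMemory (m : ℕ) (f : LossSeq V) : Prop :=
  ∀ (t : ℕ) (x y : Fin t → V),
    (∀ s : Fin t, t ≤ (s : ℕ) + m + 1 → x s = y s) → f t x = f t y

variable [Fintype V] [Nonempty V]

/-- The policy regret `∑ f_t(X_{1:t}) - min_x ∑ f_t(x, …, x)` of the play `X` over `T` rounds. -/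
def policyRegret (f : LossSeq V) (T : ℕ) (X : Fin T → V) : ℝ :=
  (∑ t : Fin T, f (t + 1) fun s => X (Fin.castLE t.isLt s)) -
    Finset.univ.inf' Finset.univ_nonempty fun x : V => ∑ t : Fin T, f (t + 1) fun _ => x

end Adversaries

/-! ## The algorithm Exp3.G -/

section Exp3G

variable {V : Type*} [Fintype V]

/-- The inputs of Exp3.G besides the graph: learning rate `η`, exploration rate `γ`
and exploration set `U`. -/
structure Tuning (V : Type*) where
  /-- learning rate -/
  η : ℝ
  /-- exploration rate -/
  γ : ℝ
  /-- exploration set -/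
  U : Finset V

open Classical in
/-- The sampling distribution `p = (1 - γ) q + γ u`, with `u` uniform on `U`. -/
def Tuning.mix (P : Tuning V) (q : V → ℝ) (i : V) : ℝ :=
  (1 - P.γ) * q i + P.γ * (if i ∈ P.U then 1 / (P.U.card : ℝ) else 0)

open Classical in
/-- The importance-weighted estimate of the loss vector `ℓ`, when `x` was drawn from `p`.
It uses `ℓ` only on the out-neighbours of `x`. -/
def lossEstimate (G : Digraph V) (p : V → ℝ) (ℓ : V → ℝ) (x i : V) : ℝ :=
  if i ∈ outNbhd G x then ℓ i / ∑ j ∈ inNbhd G i, p j else 0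

/-- The exponential update of `q`, given the vector of loss estimates. -/
def expUpdate (η : ℝ) (q est : V → ℝ) (i : V) : ℝ :=
  q i * Real.exp (-η * est i) / ∑ j, q j * Real.exp (-η * est j)

/-- The vector `q` of Exp3.G after `n` rounds in which the actions `h` were drawn; the loss
vector of the `(k + 1)`-st round may depend on the first `k` actions, and is `L k` of these.
Initially `q` is uniform. -/
def Tuning.weights (P : Tuning V) (G : Digraph V) (L : (k : ℕ) → (Fin k → V) → V → ℝ) :
    (n : ℕ) → (Fin n → V) → V → ℝ
  | 0, _ => fun _ => 1 / (Fintype.card V : ℝ)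
  | n + 1, h =>
      let q := P.weights G L n (Fin.init h)
      expUpdate P.η q
        (lossEstimate G (P.mix q) (L n (Fin.init h)) (h (Fin.last n)))

/-- The distribution from which Exp3.G draws its action after `n` rounds with actions `h`. -/
def Tuning.drawDist (P : Tuning V) (G : Digraph V) (L : (k : ℕ) → (Fin k → V) → V → ℝ)
    (n : ℕ) (h : Fin n → V) : V → ℝ :=
  P.mix (P.weights G L n h)

end Exp3G

/-! ## The mini-batched version -/

section MiniBatch

variable {V : Type*} [Fintype V]

/-- The loss of action `i` in the `(n + 1)`-st batch, when the first `n` batches were played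
with the actions `h`: the average of `f_t` over the `τ` rounds `t = nτ + 1, …, (n + 1)τ`
of the batch, each action of `h` being played for its whole batch and `i` in the present one. -/
def batchLoss (f : LossSeq V) (τ n : ℕ) (h : Fin n → V) (i : V) : ℝ :=
  (1 / (τ : ℝ)) * ∑ k ∈ Finset.range τ,
    f (n * τ + k + 1) fun s => if hs : (s : ℕ) / τ < n then h ⟨(s : ℕ) / τ, hs⟩ else i

/-- The number of draws of the mini-batched algorithm: one for each of the `⌊T / τ⌋` batches
and one for each of the remaining rounds. -/
def numDraws (τ T : ℕ) : ℕ := T / τ + T % τ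

/-- The index of the draw that is played in round `t + 1`. -/
def drawIndex (τ T t : ℕ) : ℕ :=
  if t < T / τ * τ then t / τ else T / τ + (t - T / τ * τ)

theorem drawIndex_lt {τ T t : ℕ} (ht : t < T) : drawIndex τ T t < numDraws τ T := by
  unfold drawIndex numDraws
  have h1 := Nat.div_add_mod T τ
  rw [Nat.mul_comm] at h1
  split_ifs with h
  · have : t / τ < T / τ := Nat.div_lt_of_lt_mul (by rwa [Nat.mul_comm])
    omega
  · omega

/-- The actions played in the rounds `1, …, T`, given the draws. -/
def playOf (τ T : ℕ) (w : Fin (numDraws τ T) → V) : Fin T → V :=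
  fun t => w ⟨drawIndex τ T t, drawIndex_lt t.isLt⟩

/-- The conditional distribution of the `(n + 1)`-st draw given the first `n` draws `h`:
that of Exp3.G, fed with the losses of the first `min n ⌊T / τ⌋` batches.
(In the rounds after the last batch, Exp3.G receives no feedback any more.) -/
def batchDrawDist (P : Tuning V) (G : Digraph V) (f : LossSeq V) (τ T n : ℕ)
    (h : Fin n → V) : V → ℝ :=
  P.drawDist G (batchLoss f τ) (min n (T / τ)) fun s => h (Fin.castLE (min_le_left _ _) s)

/-- The probability that the mini-batched algorithm draws `w`. -/
def drawProb (P : Tuning V) (G : Digraph V) (f : LossSeq V) (τ T : ℕ)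
    (w : Fin (numDraws τ T) → V) : ℝ :=
  ∏ n : Fin (numDraws τ T),
    batchDrawDist P G f τ T n (fun s => w (Fin.castLE n.isLt.le s)) (w n)

/-- The expected policy regret over `T` rounds of mini-batched Exp3.G with batch size `τ`. -/
def expectedPolicyRegret [Nonempty V] (P : Tuning V) (G : Digraph V) (τ T : ℕ)
    (f : LossSeq V) : ℝ :=
  ∑ w : Fin (numDraws τ T) → V, drawProb P G f τ T w * policyRegret f T (playOf τ T w)

/-- The tuning for strongly-observable graphs and `J` rounds of Exp3.G:
`U = V`, `γ = min {(1 / (α J))^{1/2}, 1/2}` and `η = γ / 2`. -/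
def strongTuning (G : Digraph V) (J : ℕ) : Tuning V :=
  let γ : ℝ := min ((1 / ((independenceNumber G : ℝ) * J)) ^ (1 / 2 : ℝ)) (1 / 2)
  { η := γ / 2, γ := γ, U := Finset.univ }

/-- The tuning for weakly-observable graphs and `J` rounds of Exp3.G, with exploration set `U`:
`γ = min {(|U| ln K / J)^{1/3}, 1/2}` and `η = γ² / |U|`, where `K = |V|`. -/
def weakTuning (U : Finset V) (J : ℕ) : Tuning V :=
  let γ : ℝ := min (((U.card : ℝ) * Real.log (Fintype.card V) / J) ^ (1 / 3 : ℝ)) (1 / 2)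
  { η := γ ^ 2 / U.card, γ := γ, U := U }

end MiniBatch

end

end FeedbackGame

/-!
The losses of Exp3.G may depend on its own past draws, but the conditional analysis of one round
is the usual one: the potential `-log (q y) / η`, for a fixed comparison action `y`, decreases in
expectation by the regret of the round up to an exploration cost `γ` and a second-order term
(`Tuning.sum_mix_mul_regret_add_potential_le`). Since `Tuning.weights` is normalised, the potential
is nonnegative and starts at `log K / η`, and summing over the rounds (`sum_pathProb_drift_le`)
bounds the regret (`Tuning.exp3G_regret_le`).

The second-order term is centred: `∑ q (est - ∑ q est)² ≤ ∑ q (1 - q) est²`, whose expectation is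
at most `∑ q (1 - q) / P`, where `P i` is the probability that `i` is observed. For a
strongly-observable vertex this ratio is bounded, because `P i` is at least a constant times `q i`
or `1 - q i`; for every vertex it is at most `|U| / γ` once `i` has a self-loop or an in-neighbour
in `U`. Centring requires only that `η ∑ q est` stay bounded, not that it be at most `1`: since
the number of actions is fixed, the resulting constants `exp B` are harmless. This gives regret of
order `J ^ (1/2)` (`exists_strongTuning_regret_le`) and `J ^ (2/3)`
(`exists_weakTuning_regret_le`) over `J` rounds, without logarithmic factors in `J`.

Playing each draw for a whole batch of length `τ` multiplies this regret by `τ`. A batch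
differs from the constant play of `y` only in its first `m` rounds, as the adversary remembers
only `m` actions, and the rounds after the last batch cost at most `τ`. The best constant action
against the losses `f` does not depend on the draws, so the expected policy regret is at most
`τ R + m J + τ` (`expectedPolicyRegret_le`), where `R` bounds the regret of Exp3.G against each fixed
action. The sizes `T ^ (1/3)` and `T ^ (1/4)` of the batches balance `τ R` and `m J`
(`exists_batch_bound_le`).
-/

namespace FeedbackGame

/-! ### Sequential sampling from history-dependent distributions -/

section Paths

variable {V : Type*}

/-- The probability of the path `w` of length `N` when, after each history `h` of length `n`,
the next point is drawn from `D n h`. -/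
noncomputable def pathProb (D : (n : ℕ) → (Fin n → V) → V → ℝ) (N : ℕ) (w : Fin N → V) : ℝ :=
  ∏ n : Fin N, D n (fun s => w (Fin.castLE n.isLt.le s)) (w n)

/-- The first `n` points of a path extended by one point are those of the path itself. -/
theorem snoc_castLE {n N : ℕ} (hn : n ≤ N) (hn' : n ≤ N + 1) (h : Fin N → V) (x : V)
    (s : Fin n) :
    (Fin.snoc h x : Fin (N + 1) → V) (Fin.castLE hn' s) = h (Fin.castLE hn s) :=
  Fin.snoc_castSucc (α := fun _ => V) x h (Fin.castLE hn s)

theorem pathProb_snoc (D : (n : ℕ) → (Fin n → V) → V → ℝ) (N : ℕ) (h : Fin N → V) (x : V) :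
    pathProb D (N + 1) (Fin.snoc h x : Fin (N + 1) → V) = pathProb D N h * D N h x := by
  unfold pathProb
  rw [Fin.prod_univ_castSucc]
  congr 1
  · refine Finset.prod_congr rfl fun n _ => ?_
    rw [Fin.snoc_castSucc (α := fun _ => V)]
    congr 1
    funext s
    exact snoc_castLE n.isLt.le _ h x s
  · rw [Fin.snoc_last (α := fun _ => V)]
    congr 1
    funext s
    exact snoc_castLE le_rfl _ h x s

theorem pathProb_nonneg {D : (n : ℕ) → (Fin n → V) → V → ℝ} (hD : ∀ n h x, 0 ≤ D n h x)
    (N : ℕ) (w : Fin N → V) : 0 ≤ pathProb D N w :=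
  Finset.prod_nonneg fun _ _ => hD _ _ _

/-- Two families of distributions that agree on histories shorter than `N` give the same
probabilities to the paths of length `N`. -/
theorem pathProb_congr {D D' : (n : ℕ) → (Fin n → V) → V → ℝ} {N : ℕ}
    (h : ∀ n < N, D n = D' n) (w : Fin N → V) : pathProb D N w = pathProb D' N w :=
  Finset.prod_congr rfl fun n _ => by rw [h n n.isLt]

variable [Fintype V]

theorem sum_path_succ (N : ℕ) (F : (Fin (N + 1) → V) → ℝ) :
    ∑ w, F w = ∑ h : Fin N → V, ∑ x : V, F (Fin.snoc h x : Fin (N + 1) → V) := by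
  rw [← (Fin.snocEquiv fun _ => V).sum_comp F, Fintype.sum_prod_type_right]
  rfl

/-- The expectation of a function of the first `n` points of a path does not depend on how
the path continues. -/
theorem sum_pathProb_mul_prefix {D : (n : ℕ) → (Fin n → V) → V → ℝ}
    (hD : ∀ n h, ∑ x, D n h x = 1) {n N : ℕ} (hn : n ≤ N) (φ : (Fin n → V) → ℝ) :
    ∑ w : Fin N → V, pathProb D N w * φ (fun s => w (Fin.castLE hn s)) =
      ∑ h : Fin n → V, pathProb D n h * φ h := by
  induction N, hn using Nat.le_induction with
  | base => rfl
  | succ N hn ih =>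
    rw [← ih, sum_path_succ]
    refine Finset.sum_congr rfl fun h _ => ?_
    have : ∀ x : V, (fun s : Fin n =>
        (Fin.snoc h x : Fin (N + 1) → V) (Fin.castLE (Nat.le_succ_of_le hn) s)) =
          fun s => h (Fin.castLE hn s) := fun x => funext fun s => snoc_castLE hn _ h x s
    simp_rw [this, pathProb_snoc, mul_right_comm _ (D N h _) _, ← Finset.mul_sum, hD, mul_one]

theorem sum_pathProb {D : (n : ℕ) → (Fin n → V) → V → ℝ}
    (hD : ∀ n h, ∑ x, D n h x = 1) (N : ℕ) : ∑ w : Fin N → V, pathProb D N w = 1 := by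
  have := sum_pathProb_mul_prefix hD (Nat.zero_le N) fun _ => 1
  simpa [pathProb] using this

/-- If in each round the expected cost plus the expected increase of a potential `Φ` is at
most `b`, then the expected total cost plus the expected final potential exceeds the initial
potential by at most `b` per round. -/
theorem sum_pathProb_drift_le {D : (n : ℕ) → (Fin n → V) → V → ℝ}
    (hD0 : ∀ n h x, 0 ≤ D n h x) (hD1 : ∀ n h, ∑ x, D n h x = 1)
    (g : (n : ℕ) → (Fin n → V) → V → ℝ) (Φ : (n : ℕ) → (Fin n → V) → ℝ) (b : ℝ)
    (hstep : ∀ n (h : Fin n → V),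
      ∑ x, D n h x * (g n h x + Φ (n + 1) (Fin.snoc h x : Fin (n + 1) → V)) ≤ Φ n h + b)
    (N : ℕ) :
    ∑ w : Fin N → V, pathProb D N w *
      (∑ n : Fin N, g n (fun s => w (Fin.castLE n.isLt.le s)) (w n) + Φ N w) ≤
        Φ 0 Fin.elim0 + N * b := by
  induction N with
  | zero => simp [pathProb, Subsingleton.elim (default : Fin 0 → V) Fin.elim0]
  | succ N ih =>
    rw [sum_path_succ]
    have key : ∀ h : Fin N → V, ∑ x : V,
        pathProb D (N + 1) (Fin.snoc h x : Fin (N + 1) → V) *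
          (∑ n : Fin (N + 1), g n
              (fun s => (Fin.snoc h x : Fin (N + 1) → V) (Fin.castLE n.isLt.le s))
              ((Fin.snoc h x : Fin (N + 1) → V) n) +
            Φ (N + 1) (Fin.snoc h x : Fin (N + 1) → V)) ≤
        pathProb D N h *
          (∑ n : Fin N, g n (fun s => h (Fin.castLE n.isLt.le s)) (h n) + Φ N h) +
        pathProb D N h * b := by
      intro h
      have hs : ∀ x : V, ∑ n : Fin (N + 1), g n
              (fun s => (Fin.snoc h x : Fin (N + 1) → V) (Fin.castLE n.isLt.le s))
              ((Fin.snoc h x : Fin (N + 1) → V) n) =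
            ∑ n : Fin N, g n (fun s => h (Fin.castLE n.isLt.le s)) (h n) + g N h x := by
        intro x
        rw [Fin.sum_univ_castSucc]
        congr 1
        · refine Finset.sum_congr rfl fun n _ => ?_
          rw [Fin.snoc_castSucc (α := fun _ => V)]
          congr 1
          funext s
          exact snoc_castLE n.isLt.le _ h x s
        · rw [Fin.snoc_last (α := fun _ => V)]
          congr 1
          funext s
          exact snoc_castLE le_rfl _ h x s
      simp_rw [hs, pathProb_snoc]
      set S := ∑ n : Fin N, g n (fun s => h (Fin.castLE n.isLt.le s)) (h n)
      have hsplit : ∀ x : V, pathProb D N h * D N h x *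
            (S + g N h x + Φ (N + 1) (Fin.snoc h x : Fin (N + 1) → V)) =
          pathProb D N h * (D N h x * S) + pathProb D N h *
            (D N h x * (g N h x + Φ (N + 1) (Fin.snoc h x : Fin (N + 1) → V))) := by
        intro x; ring
      simp_rw [hsplit, Finset.sum_add_distrib, ← Finset.mul_sum, ← Finset.sum_mul, hD1]
      nlinarith [mul_le_mul_of_nonneg_left (hstep N h) (pathProb_nonneg hD0 N h)]
    refine (Finset.sum_le_sum fun h _ => key h).trans ?_
    rw [Finset.sum_add_distrib, ← Finset.sum_mul, sum_pathProb hD1]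
    push_cast
    linarith

end Paths

/-! ### Exponential weights with a shifted second-order bound -/

section ExpWeights

theorem exp_le_one_add_add_sq_mul_exp {x B : ℝ} (hB : 0 ≤ B) (hx : x ≤ B) :
    Real.exp x ≤ 1 + x + Real.exp B * x ^ 2 := by
  have hB1 : 1 ≤ Real.exp B := Real.one_le_exp hB
  rcases le_or_gt |x| 1 with h | h
  · have := (abs_le.1 (Real.abs_exp_sub_one_sub_id_le h)).2
    nlinarith [sq_nonneg x]
  · rcases lt_abs.1 h with h | h
    · have h1 : Real.exp B ≤ Real.exp B * x ^ 2 :=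
        le_mul_of_one_le_right (Real.exp_pos B).le (by nlinarith)
      linarith [Real.exp_le_exp.2 hx]
    · nlinarith [Real.exp_le_one_iff.2 (by linarith : x ≤ 0), sq_nonneg x]

variable {V : Type*} [Fintype V]

theorem expUpdate_pos {η : ℝ} {q est : V → ℝ} (hq : ∀ i, 0 < q i) (i : V) :
    0 < expUpdate η q est i :=
  div_pos (mul_pos (hq i) (Real.exp_pos _))
    (Finset.sum_pos (fun j _ => mul_pos (hq j) (Real.exp_pos _)) ⟨i, Finset.mem_univ i⟩)

theorem sum_expUpdate [Nonempty V] {η : ℝ} {q est : V → ℝ} (hq : ∀ i, 0 < q i) :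
    ∑ i, expUpdate η q est i = 1 := by
  unfold expUpdate
  rw [← Finset.sum_div]
  exact div_self (Finset.sum_pos (fun j _ => mul_pos (hq j) (Real.exp_pos _))
    Finset.univ_nonempty).ne'

/-- The variance of a nonnegative `est` under `q` is at most `∑ q (1 - q) est²`, since
`∑ (q est)² ≤ (∑ q est)²`. -/
theorem sum_mul_sub_mean_sq_le {q est : V → ℝ} (hq : ∀ i, 0 ≤ q i) (hq1 : ∑ i, q i = 1)
    (hest : ∀ i, 0 ≤ est i) :
    ∑ i, q i * ((∑ j, q j * est j) - est i) ^ 2 ≤ ∑ i, q i * (1 - q i) * est i ^ 2 := by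
  set c := ∑ j, q j * est j with hc
  have h1 : ∑ i, (q i * est i) ^ 2 ≤ c ^ 2 :=
    Finset.sum_sq_le_sq_sum_of_nonneg fun i _ => mul_nonneg (hq i) (hest i)
  have h2 : ∑ i, q i * (c - est i) ^ 2 = ∑ i, q i * est i ^ 2 - c ^ 2 := by
    have : ∀ i, q i * (c - est i) ^ 2 =
        q i * c ^ 2 - 2 * c * (q i * est i) + q i * est i ^ 2 := fun i => by ring
    simp_rw [this, Finset.sum_add_distrib, Finset.sum_sub_distrib, ← Finset.mul_sum,
      ← Finset.sum_mul, hq1, ← hc]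
    ring
  have h3 : ∑ i, q i * (1 - q i) * est i ^ 2 =
      ∑ i, q i * est i ^ 2 - ∑ i, (q i * est i) ^ 2 := by
    rw [← Finset.sum_sub_distrib]
    exact Finset.sum_congr rfl fun i _ => by ring
  linarith

/-- One exponential update changes the potential `-log (q y)` by at most
`η (est y - ∑ q est)` plus a second-order term. Shifting `est` by its mean under `q` before
expanding the exponential gives the factors `1 - q i`, which compensate for the small
probability of observing a vertex without self-loop whose weight is close to `1`. -/
theorem neg_log_expUpdate_le {η B : ℝ} {q est : V → ℝ} (hη : 0 ≤ η) (hB : 0 ≤ B)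
    (hq : ∀ i, 0 < q i) (hq1 : ∑ i, q i = 1) (hest : ∀ i, 0 ≤ est i)
    (hc : η * ∑ i, q i * est i ≤ B) (y : V) :
    -Real.log (expUpdate η q est y) ≤ -Real.log (q y) + η * est y - η * ∑ i, q i * est i +
      η ^ 2 * Real.exp B * ∑ i, q i * (1 - q i) * est i ^ 2 := by
  set c := ∑ i, q i * est i with hcdef
  set S := η ^ 2 * Real.exp B * ∑ i, q i * (1 - q i) * est i ^ 2 with hS
  set Z := ∑ j, q j * Real.exp (-η * est j) with hZ
  have hZpos : 0 < Z :=
    Finset.sum_pos (fun j _ => mul_pos (hq j) (Real.exp_pos _)) ⟨y, Finset.mem_univ y⟩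
  have hshift : Z = Real.exp (-(η * c)) * ∑ j, q j * Real.exp (η * (c - est j)) := by
    rw [hZ, Finset.mul_sum]
    refine Finset.sum_congr rfl fun j _ => ?_
    rw [mul_left_comm, ← Real.exp_add]
    ring_nf
  have hsum : ∑ j, q j * Real.exp (η * (c - est j)) ≤ 1 + S := by
    have hterm : ∀ j, q j * Real.exp (η * (c - est j)) ≤
        q j + η * (c * q j - q j * est j) +
          η ^ 2 * Real.exp B * (q j * (c - est j) ^ 2) := by
      intro j
      have hle : η * (c - est j) ≤ B := by nlinarith [mul_nonneg hη (hest j)]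
      have := mul_le_mul_of_nonneg_left (exp_le_one_add_add_sq_mul_exp hB hle) (hq j).le
      linarith
    refine (Finset.sum_le_sum fun j _ => hterm j).trans ?_
    rw [Finset.sum_add_distrib, Finset.sum_add_distrib, ← Finset.mul_sum, ← Finset.mul_sum,
      Finset.sum_sub_distrib, ← Finset.mul_sum, hq1, ← hcdef]
    have := mul_le_mul_of_nonneg_left
      (sum_mul_sub_mean_sq_le (fun i => (hq i).le) hq1 hest)
      (by positivity : 0 ≤ η ^ 2 * Real.exp B)
    linarith
  have hlogZ : Real.log Z ≤ -(η * c) + S := by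
    rw [Real.log_le_iff_le_exp hZpos, hshift, Real.exp_add]
    exact mul_le_mul_of_nonneg_left
      (hsum.trans (by linarith [Real.add_one_le_exp S])) (Real.exp_pos _).le
  have hlog : Real.log (expUpdate η q est y) = Real.log (q y) + -η * est y - Real.log Z := by
    unfold expUpdate
    rw [Real.log_div (mul_pos (hq y) (Real.exp_pos _)).ne' hZpos.ne',
      Real.log_mul (hq y).ne' (Real.exp_pos _).ne', Real.log_exp]
  rw [hlog]
  linarith

end ExpWeights

/-! ### The importance-weighted loss estimates -/

section Estimates

variable {V : Type*} [Fintype V] (G : Digraph V)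

theorem mem_inNbhd {v w : V} : w ∈ inNbhd G v ↔ G.Adj w v := by simp [inNbhd]

theorem mem_outNbhd {v w : V} : w ∈ outNbhd G v ↔ G.Adj v w := by simp [outNbhd]

theorem lossEstimate_nonneg {p ℓ : V → ℝ} (hp : ∀ i, 0 ≤ p i) (hℓ : ∀ i, 0 ≤ ℓ i) (x i : V) :
    0 ≤ lossEstimate G p ℓ x i := by
  unfold lossEstimate
  split_ifs
  · exact div_nonneg (hℓ i) (Finset.sum_nonneg fun j _ => hp j)
  · exact le_rfl

theorem lossEstimate_le {p ℓ : V → ℝ} (hp : ∀ i, 0 ≤ p i) (hℓ : ∀ i, ℓ i ≤ 1) (x i : V) :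
    lossEstimate G p ℓ x i ≤ 1 / ∑ j ∈ inNbhd G i, p j := by
  have h0 : 0 ≤ ∑ j ∈ inNbhd G i, p j := Finset.sum_nonneg fun j _ => hp j
  unfold lossEstimate
  split_ifs
  · exact div_le_div_of_nonneg_right (hℓ i) h0
  · positivity

theorem sum_mul_ite_mem_outNbhd (p : V → ℝ) (i : V) (a : ℝ) [∀ x, Decidable (i ∈ outNbhd G x)] :
    ∑ x, p x * (if i ∈ outNbhd G x then a else 0) = (∑ j ∈ inNbhd G i, p j) * a := by
  classical
  simp_rw [mul_ite, mul_zero, mem_outNbhd]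
  rw [← Finset.sum_filter, ← Finset.sum_mul]
  congr 2

theorem sum_mul_lossEstimate {p ℓ : V → ℝ} {i : V} (hP : ∑ j ∈ inNbhd G i, p j ≠ 0) :
    ∑ x, p x * lossEstimate G p ℓ x i = ℓ i := by
  unfold lossEstimate
  rw [sum_mul_ite_mem_outNbhd]
  field_simp

theorem sum_mul_lossEstimate_sq {p ℓ : V → ℝ} {i : V} (hP : ∑ j ∈ inNbhd G i, p j ≠ 0) :
    ∑ x, p x * lossEstimate G p ℓ x i ^ 2 = ℓ i ^ 2 / ∑ j ∈ inNbhd G i, p j := by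
  unfold lossEstimate
  simp_rw [ite_pow, zero_pow two_ne_zero]
  rw [sum_mul_ite_mem_outNbhd]
  field_simp

end Estimates

/-! ### The regret of Exp3.G against adaptive losses -/

section Exp3GRegret

variable {V : Type*}

theorem Tuning.mul_le_mix {P : Tuning V} (h0 : 0 ≤ P.γ) (q : V → ℝ) (i : V) :
    (1 - P.γ) * q i ≤ P.mix q i := by
  unfold Tuning.mix
  refine le_add_of_nonneg_right (mul_nonneg h0 ?_)
  split_ifs <;> positivity

theorem Tuning.div_card_le_mix {P : Tuning V} (h1 : P.γ ≤ 1) {q : V → ℝ}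
    (hq : ∀ i, 0 ≤ q i) {i : V} (hi : i ∈ P.U) : P.γ / P.U.card ≤ P.mix q i := by
  unfold Tuning.mix
  rw [if_pos hi]
  have := mul_nonneg (sub_nonneg.2 h1) (hq i)
  rw [div_eq_mul_one_div]
  linarith

theorem Tuning.mix_nonneg {P : Tuning V} (h0 : 0 ≤ P.γ) (h1 : P.γ ≤ 1) {q : V → ℝ}
    (hq : ∀ i, 0 ≤ q i) (i : V) : 0 ≤ P.mix q i :=
  (mul_nonneg (sub_nonneg.2 h1) (hq i)).trans (P.mul_le_mix h0 q i)

variable [Fintype V]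

theorem Tuning.sum_mix_mul (P : Tuning V) (q a : V → ℝ) :
    ∑ i, P.mix q i * a i =
      (1 - P.γ) * ∑ i, q i * a i + P.γ * ((∑ i ∈ P.U, a i) / P.U.card) := by
  classical
  unfold Tuning.mix
  simp_rw [add_mul, mul_assoc, Finset.sum_add_distrib, ← Finset.mul_sum, ite_mul, zero_mul,
    Finset.sum_ite_mem, Finset.univ_inter, ← Finset.mul_sum]
  ring

theorem Tuning.sum_mix {P : Tuning V} (hU : P.U.Nonempty) {q : V → ℝ} (hq : ∑ i, q i = 1) :
    ∑ i, P.mix q i = 1 := by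
  have hc : (P.U.card : ℝ) ≠ 0 := by exact_mod_cast hU.card_pos.ne'
  have := P.sum_mix_mul q fun _ => 1
  simp only [mul_one, hq, Finset.sum_const, nsmul_eq_mul, div_self hc] at this
  linarith

/-- Exploration costs at most `γ` per round when the losses lie in `[0, 1]`. -/
theorem Tuning.sum_mix_mul_le {P : Tuning V} (h0 : 0 ≤ P.γ) {q ℓ : V → ℝ}
    (hq : ∀ i, 0 ≤ q i) (hℓ0 : ∀ i, 0 ≤ ℓ i) (hℓ1 : ∀ i, ℓ i ≤ 1) :
    ∑ i, P.mix q i * ℓ i ≤ ∑ i, q i * ℓ i + P.γ := by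
  rw [P.sum_mix_mul]
  have h1 : 0 ≤ ∑ i, q i * ℓ i := Finset.sum_nonneg fun i _ => mul_nonneg (hq i) (hℓ0 i)
  have h2 : (∑ i ∈ P.U, ℓ i) / P.U.card ≤ 1 := by
    refine div_le_one_of_le₀ ?_ (by positivity)
    simpa using Finset.sum_le_sum fun i (_ : i ∈ P.U) => hℓ1 i
  nlinarith [mul_nonneg h0 h1, mul_le_mul_of_nonneg_left h2 h0]

theorem Tuning.weights_pos_and_sum [Nonempty V] (P : Tuning V) (G : Digraph V)
    (L : (k : ℕ) → (Fin k → V) → V → ℝ) (n : ℕ) (h : Fin n → V) :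
    (∀ i, 0 < P.weights G L n h i) ∧ ∑ i, P.weights G L n h i = 1 := by
  have hK : (0 : ℝ) < Fintype.card V := by exact_mod_cast Fintype.card_pos
  induction n with
  | zero =>
    refine ⟨fun i => by simpa [Tuning.weights] using hK, ?_⟩
    simp [Tuning.weights, hK.ne']
  | succ n ih =>
    exact ⟨fun i => expUpdate_pos (ih _).1 i, sum_expUpdate (ih _).1⟩

theorem Tuning.weights_snoc (P : Tuning V) (G : Digraph V)
    (L : (k : ℕ) → (Fin k → V) → V → ℝ) (n : ℕ) (h : Fin n → V) (x : V) :
    P.weights G L (n + 1) (Fin.snoc h x : Fin (n + 1) → V) =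
      expUpdate P.η (P.weights G L n h)
        (lossEstimate G (P.mix (P.weights G L n h)) (L n h) x) := by
  simp only [Tuning.weights]
  rw [Fin.init_snoc (α := fun _ => V), Fin.snoc_last (α := fun _ => V)]

theorem Tuning.drawDist_nonneg [Nonempty V] {P : Tuning V} (h0 : 0 ≤ P.γ) (h1 : P.γ ≤ 1)
    (G : Digraph V) (L : (k : ℕ) → (Fin k → V) → V → ℝ) (n : ℕ) (h : Fin n → V) (x : V) :
    0 ≤ P.drawDist G L n h x :=
  P.mix_nonneg h0 h1 (fun i => ((P.weights_pos_and_sum G L n h).1 i).le) x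

theorem Tuning.sum_drawDist [Nonempty V] {P : Tuning V} (hU : P.U.Nonempty)
    (G : Digraph V) (L : (k : ℕ) → (Fin k → V) → V → ℝ) (n : ℕ) (h : Fin n → V) :
    ∑ x, P.drawDist G L n h x = 1 :=
  P.sum_mix hU (P.weights_pos_and_sum G L n h).2

/-- Quantitative observability under the sampling distribution of Exp3.G: whatever the
current weights `q`, each vertex `i` is observed with positive probability, and this
probability is at least `q i / M₁` and at least `q i (1 - q i) / M₂`. -/
def Tuning.ObservedWithin (P : Tuning V) (G : Digraph V) (M₁ M₂ : ℝ) : Prop :=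
  ∀ q : V → ℝ, (∀ i, 0 < q i) → ∑ i, q i = 1 → ∀ i,
    0 < ∑ j ∈ inNbhd G i, P.mix q j ∧
      q i / ∑ j ∈ inNbhd G i, P.mix q j ≤ M₁ ∧
      q i * (1 - q i) / ∑ j ∈ inNbhd G i, P.mix q j ≤ M₂

/-- In one round of Exp3.G, the expected regret against `y` plus the expected increase of the
potential `-log (q y) / η` is bounded by the cost of exploration plus the second-order term
of the exponential update. -/
theorem Tuning.sum_mix_mul_regret_add_potential_le {P : Tuning V} {G : Digraph V}
    {M₁ M₂ B : ℝ} (hη : 0 < P.η) (h0 : 0 ≤ P.γ) (h1 : P.γ ≤ 1) (hU : P.U.Nonempty)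
    (hobs : P.ObservedWithin G M₁ M₂) (hB : 0 ≤ B) (hM₁ : P.η * (Fintype.card V * M₁) ≤ B)
    {q ℓ : V → ℝ} (hq : ∀ i, 0 < q i) (hq1 : ∑ i, q i = 1) (hℓ0 : ∀ i, 0 ≤ ℓ i)
    (hℓ1 : ∀ i, ℓ i ≤ 1) (y : V) :
    ∑ x, P.mix q x * (ℓ x - ℓ y +
        P.η⁻¹ * -Real.log (expUpdate P.η q (lossEstimate G (P.mix q) ℓ x) y)) ≤
      P.η⁻¹ * -Real.log (q y) +
        (P.γ + P.η * Real.exp B * (Fintype.card V * M₂)) := by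
  set p := P.mix q with hp
  have hq0 : ∀ i, 0 ≤ q i := fun i => (hq i).le
  have hp0 : ∀ i, 0 ≤ p i := P.mix_nonneg h0 h1 hq0
  have hp1 : ∑ i, p i = 1 := P.sum_mix hU hq1
  have hqle : ∀ i, q i ≤ 1 := fun i => by
    rw [← hq1]; exact Finset.single_le_sum (fun j _ => hq0 j) (Finset.mem_univ i)
  have hobs' := hobs q hq hq1
  rw [← hp] at hobs'
  have hPne : ∀ i, ∑ j ∈ inNbhd G i, p j ≠ 0 := fun i => (hobs' i).1.ne'
  have hpoint : ∀ x, p x * (ℓ x - ℓ y +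
        P.η⁻¹ * -Real.log (expUpdate P.η q (lossEstimate G p ℓ x) y)) ≤
      p x * ℓ x + (P.η⁻¹ * -Real.log (q y) - ℓ y) * p x + p x * lossEstimate G p ℓ x y -
        ∑ i, q i * (p x * lossEstimate G p ℓ x i) +
        P.η * Real.exp B * ∑ i, q i * (1 - q i) * (p x * lossEstimate G p ℓ x i ^ 2) := by
    intro x
    have hest : ∀ i, 0 ≤ lossEstimate G p ℓ x i := lossEstimate_nonneg G hp0 hℓ0 x
    have hc : P.η * ∑ i, q i * lossEstimate G p ℓ x i ≤ B := by
      refine le_trans (mul_le_mul_of_nonneg_left ?_ hη.le) hM₁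
      have : ∀ i ∈ Finset.univ, q i * lossEstimate G p ℓ x i ≤ M₁ := fun i _ =>
        (mul_le_mul_of_nonneg_left (lossEstimate_le G hp0 hℓ1 x i) (hq0 i)).trans
          (by rw [mul_one_div]; exact (hobs' i).2.1)
      simpa using Finset.sum_le_card_nsmul _ _ _ this
    have := mul_le_mul_of_nonneg_left
      (neg_log_expUpdate_le hη.le hB hq hq1 hest hc y) (inv_nonneg.2 hη.le)
    have hcancel : P.η⁻¹ * (-Real.log (q y) + P.η * lossEstimate G p ℓ x y -
          P.η * ∑ i, q i * lossEstimate G p ℓ x i +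
          P.η ^ 2 * Real.exp B * ∑ i, q i * (1 - q i) * lossEstimate G p ℓ x i ^ 2) =
        P.η⁻¹ * -Real.log (q y) + lossEstimate G p ℓ x y -
          ∑ i, q i * lossEstimate G p ℓ x i +
          P.η * Real.exp B * ∑ i, q i * (1 - q i) * lossEstimate G p ℓ x i ^ 2 := by
      field_simp
    rw [hcancel] at this
    have h2 := mul_le_mul_of_nonneg_left this (hp0 x)
    have e1 : ∑ i, q i * (p x * lossEstimate G p ℓ x i) =
        p x * ∑ i, q i * lossEstimate G p ℓ x i := by
      rw [Finset.mul_sum]; exact Finset.sum_congr rfl fun i _ => by ring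
    have e2 : ∑ i, q i * (1 - q i) * (p x * lossEstimate G p ℓ x i ^ 2) =
        p x * ∑ i, q i * (1 - q i) * lossEstimate G p ℓ x i ^ 2 := by
      rw [Finset.mul_sum]; exact Finset.sum_congr rfl fun i _ => by ring
    rw [e1, e2]
    linarith
  refine (Finset.sum_le_sum fun x _ => hpoint x).trans ?_
  have s1 : ∑ x, ∑ i, q i * (p x * lossEstimate G p ℓ x i) = ∑ i, q i * ℓ i := by
    rw [Finset.sum_comm]
    exact Finset.sum_congr rfl fun i _ => by
      rw [← Finset.mul_sum, sum_mul_lossEstimate G (hPne i)]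
  have s2 : ∑ x, ∑ i, q i * (1 - q i) * (p x * lossEstimate G p ℓ x i ^ 2) ≤
      Fintype.card V * M₂ := by
    rw [Finset.sum_comm]
    have : ∀ i ∈ Finset.univ,
        ∑ x, q i * (1 - q i) * (p x * lossEstimate G p ℓ x i ^ 2) ≤ M₂ := by
      intro i _
      rw [← Finset.mul_sum, sum_mul_lossEstimate_sq G (hPne i), ← mul_div_assoc]
      refine le_trans (div_le_div_of_nonneg_right ?_ (hobs' i).1.le) (hobs' i).2.2
      exact mul_le_of_le_one_right (mul_nonneg (hq0 i) (by linarith [hqle i]))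
        (pow_le_one₀ (hℓ0 i) (hℓ1 i))
    simpa using Finset.sum_le_card_nsmul _ _ _ this
  rw [Finset.sum_add_distrib, Finset.sum_sub_distrib, Finset.sum_add_distrib,
    Finset.sum_add_distrib, ← Finset.mul_sum, ← Finset.mul_sum, hp1, s1,
    sum_mul_lossEstimate G (hPne y)]
  have h3 := P.sum_mix_mul_le h0 hq0 hℓ0 hℓ1
  rw [← hp] at h3
  have h4 := mul_le_mul_of_nonneg_left s2 (by positivity : 0 ≤ P.η * Real.exp B)
  linarith

/-- The expected regret of `J` rounds of Exp3.G against a fixed action, for losses that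
depend on the past actions of the algorithm. -/
theorem Tuning.exp3G_regret_le [Nonempty V] {P : Tuning V} {G : Digraph V}
    {M₁ M₂ B : ℝ} (hη : 0 < P.η) (h0 : 0 ≤ P.γ) (h1 : P.γ ≤ 1) (hU : P.U.Nonempty)
    (hobs : P.ObservedWithin G M₁ M₂) (hB : 0 ≤ B) (hM₁ : P.η * (Fintype.card V * M₁) ≤ B)
    {L : (k : ℕ) → (Fin k → V) → V → ℝ} (hL : ∀ k h i, L k h i ∈ Set.Icc (0 : ℝ) 1)
    (J : ℕ) (y : V) :
    ∑ w : Fin J → V, pathProb (P.drawDist G L) J w *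
        ∑ n : Fin J, (L n (fun s => w (Fin.castLE n.isLt.le s)) (w n) -
          L n (fun s => w (Fin.castLE n.isLt.le s)) y) ≤
      Real.log (Fintype.card V) / P.η +
        J * (P.γ + P.η * Real.exp B * (Fintype.card V * M₂)) := by
  have hdrift := sum_pathProb_drift_le (P.drawDist_nonneg h0 h1 G L) (P.sum_drawDist hU G L)
    (fun n h x => L n h x - L n h y)
    (fun n h => P.η⁻¹ * -Real.log (P.weights G L n h y))
    (P.γ + P.η * Real.exp B * (Fintype.card V * M₂))
    (fun n h => by
      have hw := P.weights_pos_and_sum G L n h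
      simp_rw [P.weights_snoc]
      exact P.sum_mix_mul_regret_add_potential_le hη h0 h1 hU hobs hB hM₁ hw.1 hw.2
        (fun i => (hL n h i).1) (fun i => (hL n h i).2) y) J
  have hinit : P.η⁻¹ * -Real.log (P.weights G L 0 Fin.elim0 y) =
      Real.log (Fintype.card V) / P.η := by
    simp only [Tuning.weights, one_div, Real.log_inv, neg_neg]
    ring
  rw [hinit] at hdrift
  refine le_trans (Finset.sum_le_sum fun w _ => ?_) hdrift
  refine mul_le_mul_of_nonneg_left ?_ (pathProb_nonneg (P.drawDist_nonneg h0 h1 G L) J w)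
  have hw := P.weights_pos_and_sum G L J w
  have hle : P.weights G L J w y ≤ 1 := by
    rw [← hw.2]
    exact Finset.single_le_sum (fun j _ => (hw.1 j).le) (Finset.mem_univ y)
  exact le_add_of_nonneg_right (mul_nonneg (inv_nonneg.2 hη.le)
    (neg_nonneg.2 (Real.log_nonpos (hw.1 y).le hle)))

end Exp3GRegret

/-! ### Observation probabilities in feedback graphs -/

section Observability

variable {V : Type*} [Fintype V] {G : Digraph V}

theorem stronglyObservableAt_iff {v : V} :
    StronglyObservableAt G v ↔ G.Adj v v ∨ ∀ w, w ≠ v → G.Adj w v := by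
  classical
  unfold StronglyObservableAt
  rw [Finset.singleton_subset_iff, mem_inNbhd, Finset.subset_iff]
  simp [mem_inNbhd]

theorem Tuning.mix_le_sum_inNbhd {P : Tuning V} (h0 : 0 ≤ P.γ) (h1 : P.γ ≤ 1) {q : V → ℝ}
    (hq : ∀ i, 0 ≤ q i) {d i : V} (hd : G.Adj d i) :
    P.mix q d ≤ ∑ j ∈ inNbhd G i, P.mix q j :=
  Finset.single_le_sum (fun j _ => P.mix_nonneg h0 h1 hq j) ((mem_inNbhd G).2 hd)

/-- A strongly-observable vertex `i` is observed with probability at least a constant times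
`q i (1 - q i)`: its self-loop contributes `q i`, or else the other vertices contribute
`1 - q i`. -/
theorem Tuning.mul_one_sub_le_sum_inNbhd {P : Tuning V} (h0 : 0 ≤ P.γ) (h1 : P.γ ≤ 1)
    {q : V → ℝ} (hq : ∀ i, 0 ≤ q i) (hq1 : ∑ i, q i = 1) {i : V}
    (hi : StronglyObservableAt G i) :
    (1 - P.γ) * (q i * (1 - q i)) ≤ ∑ j ∈ inNbhd G i, P.mix q j := by
  classical
  have hqi : q i ≤ 1 := by
    rw [← hq1]; exact Finset.single_le_sum (fun j _ => hq j) (Finset.mem_univ i)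
  have hγ : 0 ≤ 1 - P.γ := sub_nonneg.2 h1
  rcases stronglyObservableAt_iff.1 hi with h | h
  · calc (1 - P.γ) * (q i * (1 - q i)) ≤ (1 - P.γ) * q i :=
          mul_le_mul_of_nonneg_left (mul_le_of_le_one_right (hq i) (by linarith [hq i])) hγ
      _ ≤ P.mix q i := P.mul_le_mix h0 q i
      _ ≤ _ := P.mix_le_sum_inNbhd h0 h1 hq h
  · have hrest : ∑ j ∈ Finset.univ.erase i, q j = 1 - q i := by
      rw [← hq1, ← Finset.add_sum_erase _ _ (Finset.mem_univ i)]
      ring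
    calc (1 - P.γ) * (q i * (1 - q i)) ≤ (1 - P.γ) * (1 - q i) :=
          mul_le_mul_of_nonneg_left (mul_le_of_le_one_left (by linarith) hqi) hγ
      _ = ∑ j ∈ Finset.univ.erase i, (1 - P.γ) * q j := by rw [← Finset.mul_sum, hrest]
      _ ≤ ∑ j ∈ Finset.univ.erase i, P.mix q j :=
          Finset.sum_le_sum fun j _ => P.mul_le_mix h0 q j
      _ ≤ _ := Finset.sum_le_sum_of_subset_of_nonneg
          (fun j hj => (mem_inNbhd G).2 (h j (Finset.ne_of_mem_erase hj)))
          fun j _ _ => P.mix_nonneg h0 h1 hq j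

theorem StronglyObservable.exists_adj [Nontrivial V] (hG : StronglyObservable G) (i : V) :
    ∃ d, G.Adj d i := by
  rcases stronglyObservableAt_iff.1 (hG i) with h | h
  · exact ⟨i, h⟩
  · obtain ⟨d, hd⟩ := exists_ne i
    exact ⟨d, h d hd⟩

theorem Tuning.observedWithin_of_stronglyObservable [Nontrivial V] {P : Tuning V}
    (h0 : 0 < P.γ) (h1 : P.γ ≤ 1 / 2) (hU : P.U = Finset.univ) (hG : StronglyObservable G) :
    P.ObservedWithin G (Fintype.card V / P.γ) 2 := by
  intro q hq hq1 i
  have hK : (0 : ℝ) < Fintype.card V := by exact_mod_cast Fintype.card_pos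
  have hq0 : ∀ i, 0 ≤ q i := fun i => (hq i).le
  have hqi : q i ≤ 1 := by
    rw [← hq1]; exact Finset.single_le_sum (fun j _ => hq0 j) (Finset.mem_univ i)
  obtain ⟨d, hd⟩ := hG.exists_adj i
  have hlow : P.γ / Fintype.card V ≤ ∑ j ∈ inNbhd G i, P.mix q j := by
    have := P.div_card_le_mix (by linarith) hq0 (i := d) (by simp [hU])
    rw [hU, Finset.card_univ] at this
    exact this.trans (P.mix_le_sum_inNbhd h0.le (by linarith) hq0 hd)
  have hpos : 0 < ∑ j ∈ inNbhd G i, P.mix q j := (div_pos h0 hK).trans_le hlow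
  refine ⟨hpos, ?_, ?_⟩
  · calc q i / ∑ j ∈ inNbhd G i, P.mix q j ≤ 1 / (P.γ / Fintype.card V) :=
          div_le_div₀ zero_le_one hqi (div_pos h0 hK) hlow
      _ = _ := one_div_div _ _
  · rw [div_le_iff₀ hpos]
    have := P.mul_one_sub_le_sum_inNbhd h0.le (by linarith) hq0 hq1 (hG i)
    nlinarith [mul_nonneg (hq0 i) (sub_nonneg.2 hqi)]

/-- A vertex without self-loop has an in-neighbour in every admissible exploration set. A
strongly-observable one is seen by all other vertices, so only the exploration set
consisting of that vertex alone would miss it. -/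
theorem exists_adj_of_weaklyDominating (hG : Observable G) {U : Finset V}
    (hUne : U.Nonempty) (hU : WeaklyDominating G U) (hU1 : ∀ d, U = {d} → G.Adj d d) {i : V}
    (hi : ¬ G.Adj i i) : ∃ d ∈ U, G.Adj d i := by
  by_cases hs : StronglyObservableAt G i
  · have h := (stronglyObservableAt_iff.1 hs).resolve_left hi
    have : ∃ d ∈ U, d ≠ i := by
      by_contra! hcon
      exact hi (hU1 i (Finset.eq_singleton_iff_nonempty_unique_mem.2 ⟨hUne, hcon⟩))
    obtain ⟨d, hdU, hd⟩ := this
    exact ⟨d, hdU, h d hd⟩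
  · obtain ⟨d, hdU, hd⟩ := hU i ⟨hG i, hs⟩
    exact ⟨d, hdU, (mem_outNbhd G).1 hd⟩

theorem Tuning.observedWithin_of_weaklyDominating {P : Tuning V}
    (h0 : 0 < P.γ) (h1 : P.γ ≤ 1 / 2) (hG : Observable G) (hUne : P.U.Nonempty)
    (hU : WeaklyDominating G P.U) (hU1 : ∀ d, P.U = {d} → G.Adj d d) :
    P.ObservedWithin G (P.U.card / P.γ) (P.U.card / P.γ) := by
  intro q hq hq1 i
  have hc : (1 : ℝ) ≤ P.U.card := by exact_mod_cast hUne.card_pos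
  have hq0 : ∀ i, 0 ≤ q i := fun i => (hq i).le
  have hqi : q i ≤ 1 := by
    rw [← hq1]; exact Finset.single_le_sum (fun j _ => hq0 j) (Finset.mem_univ i)
  have hγU : P.γ / P.U.card ≤ 1 / 2 :=
    (div_le_self h0.le hc).trans h1
  have hlow : 0 < ∑ j ∈ inNbhd G i, P.mix q j ∧
      P.γ / P.U.card * q i ≤ ∑ j ∈ inNbhd G i, P.mix q j := by
    by_cases hi : G.Adj i i
    · have h := (P.mul_le_mix h0.le q i).trans
        (P.mix_le_sum_inNbhd h0.le (by linarith) hq0 hi)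
      constructor <;> nlinarith [hq i]
    · obtain ⟨d, hdU, hd⟩ := exists_adj_of_weaklyDominating hG hUne hU hU1 hi
      have h := (P.div_card_le_mix (by linarith) hq0 hdU).trans
        (P.mix_le_sum_inNbhd h0.le (by linarith) hq0 hd)
      have hpos : 0 < P.γ / P.U.card := by positivity
      exact ⟨hpos.trans_le h, (mul_le_of_le_one_right hpos.le hqi).trans h⟩
  have hM : q i / ∑ j ∈ inNbhd G i, P.mix q j ≤ P.U.card / P.γ := by
    rw [div_le_iff₀ hlow.1]
    calc q i = P.U.card / P.γ * (P.γ / P.U.card * q i) := by field_simp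
      _ ≤ _ := mul_le_mul_of_nonneg_left hlow.2 (by positivity)
  refine ⟨hlow.1, hM, le_trans (div_le_div_of_nonneg_right ?_ hlow.1.le) hM⟩
  exact mul_le_of_le_one_right (hq0 i) (by linarith [hq i])

theorem one_le_independenceNumber [Nonempty V] (G : Digraph V) : 1 ≤ independenceNumber G := by
  classical
  obtain ⟨v⟩ := ‹Nonempty V›
  unfold independenceNumber
  refine (Finset.card_singleton v).symm.le.trans (Finset.le_sup (f := Finset.card) ?_)
  simp only [Finset.mem_filter, Finset.mem_univ, true_and]
  intro a ha b hb hab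
  rw [Finset.mem_singleton] at ha hb
  exact absurd (ha.trans hb.symm) hab

theorem WeaklyObservable.exists_weaklyObservableAt (hG : WeaklyObservable G) :
    ∃ v, WeaklyObservableAt G v := by
  obtain ⟨v, hv⟩ := not_forall.1 hG.2
  exact ⟨v, hG.1 v, hv⟩

theorem WeaklyObservable.nontrivial (hG : WeaklyObservable G) : Nontrivial V := by
  obtain ⟨v, -, hv⟩ := hG.exists_weaklyObservableAt
  rw [stronglyObservableAt_iff, not_or] at hv
  obtain ⟨w, hw⟩ := not_forall.1 hv.2
  exact ⟨w, v, fun h => hw fun h' => absurd h h'⟩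

theorem WeaklyObservable.nonempty_of_weaklyDominating (hG : WeaklyObservable G) {U : Finset V}
    (hU : WeaklyDominating G U) : U.Nonempty := by
  obtain ⟨v, hv⟩ := hG.exists_weaklyObservableAt
  obtain ⟨d, hd, -⟩ := hU v hv
  exact ⟨d, hd⟩

theorem weaklyDominating_univ (G : Digraph V) : WeaklyDominating G Finset.univ := by
  intro v hv
  obtain ⟨d, hd⟩ := hv.1
  exact ⟨d, Finset.mem_univ d, (mem_outNbhd G).2 ((mem_inNbhd G).1 hd)⟩

end Observability

/-! ### Regret rates of Exp3.G for the two tunings -/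

section Rates

variable {V : Type*} [Fintype V] [Nonempty V] {G : Digraph V}

theorem inv_min_half_pow_le {x : ℝ} (hx : 0 < x) (n : ℕ) :
    (1 / min x (1 / 2)) ^ n ≤ (1 / x) ^ n + 2 ^ n := by
  have h1 : 0 ≤ (1 / x) ^ n := by positivity
  rcases min_choice x (1 / 2) with h | h <;> rw [h]
  · linarith [pow_pos (two_pos : (0 : ℝ) < 2) n]
  · norm_num
    positivity

/-- Exp3.G with the tuning for strongly-observable graphs has regret of order `J ^ (1/2)`. -/
theorem exists_strongTuning_regret_le (hG : StronglyObservable G) :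
    ∃ A : ℝ, 0 ≤ A ∧ ∀ (J : ℕ) (L : (k : ℕ) → (Fin k → V) → V → ℝ),
      (∀ k h i, L k h i ∈ Set.Icc (0 : ℝ) 1) → ∀ y : V,
      ∑ w : Fin J → V, pathProb ((strongTuning G J).drawDist G L) J w *
        ∑ n : Fin J, (L n (fun s => w (Fin.castLE n.isLt.le s)) (w n) -
          L n (fun s => w (Fin.castLE n.isLt.le s)) y) ≤ A * (J : ℝ) ^ (1 / 2 : ℝ) := by
  rcases subsingleton_or_nontrivial V with hV | hV
  · refine ⟨0, le_rfl, fun J L _ y => ?_⟩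
    rw [zero_mul]
    refine Finset.sum_nonpos fun w _ => ?_
    rw [Finset.sum_eq_zero fun n _ => by rw [Subsingleton.elim (w n) y, sub_self], mul_zero]
  set K : ℝ := ((Fintype.card V : ℕ) : ℝ) with hK
  set α : ℝ := ((independenceNumber G : ℕ) : ℝ) with hα
  have hK1 : 1 ≤ K := Nat.one_le_cast.2 Fintype.card_pos
  have hα1 : 1 ≤ α := Nat.one_le_cast.2 (one_le_independenceNumber G)
  have hlog : 0 ≤ Real.log K := Real.log_nonneg hK1
  refine ⟨2 * Real.log K * (α ^ (1 / 2 : ℝ) + 2) + (1 + Real.exp (K ^ 2 / 2) * K),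
    by positivity, fun J L hL y => ?_⟩
  rcases Nat.eq_zero_or_pos J with rfl | hJ
  · simp
  have hJ1 : (1 : ℝ) ≤ J := by exact_mod_cast hJ
  set P := strongTuning G J with hP
  set x : ℝ := (1 / (α * J)) ^ (1 / 2 : ℝ) with hx
  have hxpos : 0 < x := by positivity
  have hγ : P.γ = min x (1 / 2) := rfl
  have hη : P.η = P.γ / 2 := rfl
  have hγ0 : 0 < P.γ := by rw [hγ]; positivity
  have hγh : P.γ ≤ 1 / 2 := by rw [hγ]; exact min_le_right _ _
  have hmain := P.exp3G_regret_le (G := G) (B := K ^ 2 / 2) (by rw [hη]; positivity) hγ0.le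
    (by linarith) Finset.univ_nonempty
    (P.observedWithin_of_stronglyObservable hγ0 hγh rfl hG) (by positivity)
    (by rw [hη, ← hK]; apply le_of_eq; field_simp) hL J y
  refine hmain.trans ?_
  have hinv : 1 / P.γ ≤ (α ^ (1 / 2 : ℝ) + 2) * (J : ℝ) ^ (1 / 2 : ℝ) := by
    have h1 := inv_min_half_pow_le hxpos 1
    rw [pow_one, pow_one, pow_one, ← hγ] at h1
    have h2 : 1 / x = α ^ (1 / 2 : ℝ) * (J : ℝ) ^ (1 / 2 : ℝ) := by
      rw [hx, Real.div_rpow zero_le_one (by positivity), Real.one_rpow, one_div_one_div,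
        Real.mul_rpow (by positivity) (by positivity)]
    have h3 : 1 ≤ (J : ℝ) ^ (1 / 2 : ℝ) := Real.one_le_rpow hJ1 (by norm_num)
    nlinarith
  have hJγ : J * P.γ ≤ (J : ℝ) ^ (1 / 2 : ℝ) := by
    have h1 : P.γ ≤ (1 / (J : ℝ)) ^ (1 / 2 : ℝ) := by
      rw [hγ]
      refine (min_le_left _ _).trans (Real.rpow_le_rpow (by positivity) ?_ (by norm_num))
      exact one_div_le_one_div_of_le (by positivity) (le_mul_of_one_le_left (by positivity) hα1)
    calc J * P.γ ≤ J * (1 / (J : ℝ)) ^ (1 / 2 : ℝ) :=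
          mul_le_mul_of_nonneg_left h1 (by positivity)
      _ = (J : ℝ) ^ (1 / 2 : ℝ) := by
        rw [one_div, Real.inv_rpow (by positivity), ← Real.rpow_neg (by positivity)]
        nth_rewrite 1 [← Real.rpow_one (J : ℝ)]
        rw [← Real.rpow_add (by positivity)]
        norm_num
  have e1 : Real.log K / P.η = 2 * Real.log K * (1 / P.γ) := by rw [hη]; field_simp
  have e2 : J * (P.γ + P.η * Real.exp (K ^ 2 / 2) * (K * 2)) =
      (1 + Real.exp (K ^ 2 / 2) * K) * (J * P.γ) := by rw [hη]; ring
  rw [e1, e2]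
  have b1 := mul_le_mul_of_nonneg_left hinv (by positivity : 0 ≤ 2 * Real.log K)
  have b2 := mul_le_mul_of_nonneg_left hJγ (by positivity : 0 ≤ 1 + Real.exp (K ^ 2 / 2) * K)
  linarith

/-- Exp3.G with the tuning for weakly-observable graphs has regret of order `J ^ (2/3)`. -/
theorem exists_weakTuning_regret_le (hG : WeaklyObservable G) {U : Finset V}
    (hU : WeaklyDominating G U) (hU1 : ∀ d, U = {d} → G.Adj d d) :
    ∃ A : ℝ, 0 ≤ A ∧ ∀ (J : ℕ) (L : (k : ℕ) → (Fin k → V) → V → ℝ),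
      (∀ k h i, L k h i ∈ Set.Icc (0 : ℝ) 1) → ∀ y : V,
      ∑ w : Fin J → V, pathProb ((weakTuning U J).drawDist G L) J w *
        ∑ n : Fin J, (L n (fun s => w (Fin.castLE n.isLt.le s)) (w n) -
          L n (fun s => w (Fin.castLE n.isLt.le s)) y) ≤ A * (J : ℝ) ^ (2 / 3 : ℝ) := by
  have hV := hG.nontrivial
  have hUne := hG.nonempty_of_weaklyDominating hU
  set K : ℝ := ((Fintype.card V : ℕ) : ℝ) with hK
  have hK1 : 1 < K := Nat.one_lt_cast.2 Fintype.one_lt_card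
  have hc1 : (1 : ℝ) ≤ U.card := by exact_mod_cast hUne.card_pos
  have hlog : 0 < Real.log K := Real.log_pos hK1
  set c : ℝ := U.card * Real.log K with hc
  have hcpos : 0 < c := by positivity
  refine ⟨c * (1 / c ^ (2 / 3 : ℝ) + 4) + (1 + Real.exp K * K) * c ^ (1 / 3 : ℝ),
    by positivity, fun J L hL y => ?_⟩
  rcases Nat.eq_zero_or_pos J with rfl | hJ
  · simp
  have hJ1 : (1 : ℝ) ≤ J := by exact_mod_cast hJ
  set P := weakTuning U J with hP
  set x : ℝ := (c / J) ^ (1 / 3 : ℝ) with hx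
  have hxpos : 0 < x := by positivity
  have hγ : P.γ = min x (1 / 2) := rfl
  have hη : P.η = P.γ ^ 2 / U.card := rfl
  have hPU : P.U = U := rfl
  have hγ0 : 0 < P.γ := by rw [hγ]; positivity
  have hγh : P.γ ≤ 1 / 2 := by rw [hγ]; exact min_le_right _ _
  have hmain := P.exp3G_regret_le (G := G) (B := K) (by rw [hη]; positivity) hγ0.le
    (by linarith) hUne (P.observedWithin_of_weaklyDominating hγ0 hγh hG.1 hUne hU hU1)
    (by positivity)
    (by
      rw [hη, hPU, ← hK]
      have : P.γ ^ 2 / U.card * (K * (U.card / P.γ)) = P.γ * K := by field_simp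
      rw [this]
      nlinarith) hL J y
  refine hmain.trans ?_
  have hinv : (1 / P.γ) ^ 2 ≤ (1 / c ^ (2 / 3 : ℝ) + 4) * (J : ℝ) ^ (2 / 3 : ℝ) := by
    have h1 := inv_min_half_pow_le hxpos 2
    rw [← hγ] at h1
    have h2 : (1 / x) ^ 2 = 1 / c ^ (2 / 3 : ℝ) * (J : ℝ) ^ (2 / 3 : ℝ) := by
      rw [div_pow, one_pow, hx, ← Real.rpow_natCast, ← Real.rpow_mul (by positivity),
        Real.div_rpow hcpos.le (by positivity)]
      norm_num
      rw [div_eq_mul_inv, mul_comm]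
    have h3 : 1 ≤ (J : ℝ) ^ (2 / 3 : ℝ) := Real.one_le_rpow hJ1 (by norm_num)
    linarith
  have hJγ : J * P.γ ≤ c ^ (1 / 3 : ℝ) * (J : ℝ) ^ (2 / 3 : ℝ) := by
    calc J * P.γ ≤ J * x :=
          mul_le_mul_of_nonneg_left (by rw [hγ]; exact min_le_left _ _) (by positivity)
      _ = c ^ (1 / 3 : ℝ) * ((J : ℝ) ^ (1 : ℝ) * (J : ℝ) ^ (-(1 / 3) : ℝ)) := by
        rw [hx, Real.div_rpow hcpos.le (by positivity), Real.rpow_one,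
          Real.rpow_neg (by positivity)]
        ring
      _ = c ^ (1 / 3 : ℝ) * (J : ℝ) ^ (2 / 3 : ℝ) := by
        rw [← Real.rpow_add (by positivity)]
        norm_num
  have e1 : Real.log K / P.η = c * (1 / P.γ) ^ 2 := by rw [hη, hc]; field_simp
  have e2 : J * (P.γ + P.η * Real.exp K * (K * (U.card / P.γ))) =
      (1 + Real.exp K * K) * (J * P.γ) := by rw [hη]; field_simp
  rw [hPU, e1, e2]
  have b1 := mul_le_mul_of_nonneg_left hinv hcpos.le
  have b2 := mul_le_mul_of_nonneg_left hJγ (by positivity : 0 ≤ 1 + Real.exp K * K)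
  linarith

end Rates

/-! ### Reduction of the policy regret to the regret over batches -/

section Batches

variable {V : Type*} {f : LossSeq V} {τ m : ℕ}

theorem mul_batchLoss (hτ : 0 < τ) (n : ℕ) (h : Fin n → V) (i : V) :
    τ * batchLoss f τ n h i = ∑ k ∈ Finset.range τ,
      f (n * τ + k + 1) fun s => if hs : (s : ℕ) / τ < n then h ⟨(s : ℕ) / τ, hs⟩ else i := by
  have : (τ : ℝ) ≠ 0 := by exact_mod_cast hτ.ne'
  unfold batchLoss
  rw [← mul_assoc, mul_one_div_cancel this, one_mul]

theorem batchLoss_mem_Icc (hf : UnitLosses f) (hτ : 0 < τ) (n : ℕ) (h : Fin n → V) (i : V) :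
    batchLoss f τ n h i ∈ Set.Icc (0 : ℝ) 1 := by
  have hτ' : (0 : ℝ) < τ := by exact_mod_cast hτ
  unfold batchLoss
  constructor
  · exact mul_nonneg (by positivity) (Finset.sum_nonneg fun k _ => (hf _ _).1)
  · rw [one_div, inv_mul_le_iff₀ hτ', mul_one]
    simpa using Finset.sum_le_card_nsmul (Finset.range τ) _ 1
      fun k _ => (hf (n * τ + k + 1) _).2

/-- In a batch in which `y` is played, the total loss exceeds that of the constant play of
`y` by at most `m`: only the first `m` rounds of the batch depend on earlier actions. -/
theorem mul_batchLoss_le (hf : UnitLosses f) (hm : HasMemory m f) (hτ : m < τ) (n : ℕ)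
    (h : Fin n → V) (y : V) :
    τ * batchLoss f τ n h y ≤
      ∑ k ∈ Finset.range τ, f (n * τ + k + 1) (fun _ => y) + m := by
  rw [mul_batchLoss (by omega)]
  have hone : ∑ k ∈ Finset.range τ, (if k < m then (1 : ℝ) else 0) = m := by
    rw [← Finset.sum_filter, Finset.sum_const, nsmul_eq_mul, mul_one]
    congr 1
    have : (Finset.range τ).filter (· < m) = Finset.range m := by
      ext k; simp only [Finset.mem_filter, Finset.mem_range]; omega
    rw [this, Finset.card_range]
  rw [← hone, ← Finset.sum_add_distrib]
  refine Finset.sum_le_sum fun k _ => ?_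
  split_ifs with hk
  · linarith [(hf (n * τ + k + 1)
      fun s => if hs : (s : ℕ) / τ < n then h ⟨(s : ℕ) / τ, hs⟩ else y).2,
      (hf (n * τ + k + 1) fun _ => y).1]
  · rw [add_zero]
    refine (hm _ _ _ fun s hs => dif_neg ?_).le
    rw [not_lt, Nat.le_div_iff_mul_le (by omega)]
    omega

theorem sum_range_mul_eq (F : ℕ → ℝ) (J τ : ℕ) :
    ∑ t ∈ Finset.range (J * τ), F t =
      ∑ n ∈ Finset.range J, ∑ k ∈ Finset.range τ, F (n * τ + k) := by
  induction J with
  | zero => simp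
  | succ J ih => rw [Nat.succ_mul, Finset.sum_range_add, ih, Finset.sum_range_succ]

variable [Fintype V]

/-- The draws in the batches are those of Exp3.G fed with the batch losses. -/
theorem batchDrawDist_of_le (P : Tuning V) (G : Digraph V) (f : LossSeq V) {T n : ℕ}
    (hn : n ≤ T / τ) : batchDrawDist P G f τ T n = P.drawDist G (batchLoss f τ) n := by
  have key : ∀ (k : ℕ) (hk : k = n) (hle : k ≤ n) (h : Fin n → V),
      P.drawDist G (batchLoss f τ) k (fun s => h (Fin.castLE hle s)) =
        P.drawDist G (batchLoss f τ) n h := by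
    rintro k rfl hle h
    rfl
  funext h
  exact key _ (min_eq_left hn) _ h

variable [Nonempty V]

/-- Each batch loses at most `m` through the memory of the adversary, and the rounds after
the last batch at most `1` each. -/
theorem exists_policyRegret_playOf_le (hf : UnitLosses f) (hm : HasMemory m f) (hτ : m < τ)
    (T : ℕ) : ∃ y : V, ∀ w : Fin (numDraws τ T) → V,
      policyRegret f T (playOf τ T w) ≤
        τ * ∑ n : Fin (T / τ),
          (batchLoss f τ n
              (fun s => w (Fin.castLE (Nat.le_add_right _ _) (Fin.castLE n.isLt.le s)))
              (w (Fin.castLE (Nat.le_add_right _ _) n)) -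
            batchLoss f τ n
              (fun s => w (Fin.castLE (Nat.le_add_right _ _) (Fin.castLE n.isLt.le s))) y) +
          m * (T / τ : ℕ) + τ := by
  obtain ⟨y, -, hy⟩ := Finset.exists_mem_eq_inf' (Finset.univ_nonempty (α := V))
    fun x : V => ∑ t : Fin T, f (t + 1) fun _ => x
  refine ⟨y, fun w => ?_⟩
  have hτ0 : 0 < τ := by omega
  unfold policyRegret
  rw [hy]
  set J := T / τ with hJ
  let W : ℕ → V := fun k => if hk : k < numDraws τ T then w ⟨k, hk⟩ else y
  have hW : ∀ k (hk : k < numDraws τ T), W k = w ⟨k, hk⟩ := fun k hk => dif_pos hk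
  have hN : J ≤ numDraws τ T := Nat.le_add_right _ _
  let F : ℕ → ℝ := fun t => f (t + 1) fun s => W (drawIndex τ T s)
  let C : ℕ → ℝ := fun t => f (t + 1) fun _ => y
  have hF : ∑ t : Fin T, f (t + 1) (fun s => playOf τ T w (Fin.castLE t.isLt s)) =
      ∑ t ∈ Finset.range T, F t := by
    rw [← Fin.sum_univ_eq_sum_range F T]
    refine Finset.sum_congr rfl fun t _ => ?_
    refine congrArg (f (t + 1)) (funext fun s => ?_)
    exact (hW _ (drawIndex_lt (Fin.castLE t.isLt s).isLt)).symm
  rw [hF, Fin.sum_univ_eq_sum_range C T]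
  have hT : T = J * τ + T % τ := by
    rw [hJ, Nat.mul_comm]; exact (Nat.div_add_mod T τ).symm
  have hsplit : ∀ H : ℕ → ℝ, ∑ t ∈ Finset.range T, H t =
      ∑ n ∈ Finset.range J, ∑ k ∈ Finset.range τ, H (n * τ + k) +
        ∑ k ∈ Finset.range (T % τ), H (J * τ + k) := by
    intro H
    conv_lhs => rw [hT]
    rw [Finset.sum_range_add, sum_range_mul_eq]
  rw [hsplit F, hsplit C]
  have hrest : ∑ k ∈ Finset.range (T % τ), F (J * τ + k) ≤
      ∑ k ∈ Finset.range (T % τ), C (J * τ + k) + τ := by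
    have h1 : ∑ k ∈ Finset.range (T % τ), F (J * τ + k) ≤ (T % τ : ℕ) := by
      simpa using Finset.sum_le_card_nsmul (Finset.range (T % τ))
        (fun k => F (J * τ + k)) 1 fun k _ => (hf _ _).2
    have h2 : 0 ≤ ∑ k ∈ Finset.range (T % τ), C (J * τ + k) :=
      Finset.sum_nonneg fun k _ => (hf _ _).1
    have h3 : ((T % τ : ℕ) : ℝ) ≤ τ := by exact_mod_cast (Nat.mod_lt T hτ0).le
    linarith
  have hbatch : ∀ n ∈ Finset.range J,
      ∑ k ∈ Finset.range τ, F (n * τ + k) - ∑ k ∈ Finset.range τ, C (n * τ + k) ≤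
        τ * (batchLoss f τ n (fun s => W s) (W n) - batchLoss f τ n (fun s => W s) y) + m := by
    intro n hn
    rw [Finset.mem_range] at hn
    have h1 : ∑ k ∈ Finset.range τ, F (n * τ + k) =
        τ * batchLoss f τ n (fun s => W s) (W n) := by
      rw [mul_batchLoss hτ0]
      refine Finset.sum_congr rfl fun k hk => ?_
      rw [Finset.mem_range] at hk
      refine congrArg (f (n * τ + k + 1)) (funext fun s => ?_)
      have hs : (s : ℕ) < n * τ + k + 1 := s.isLt
      have hlt : (s : ℕ) < (n + 1) * τ := by rw [Nat.succ_mul]; omega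
      have hle : (n + 1) * τ ≤ J * τ := Nat.mul_le_mul_right τ hn
      have hdiv : (s : ℕ) / τ < n + 1 := (Nat.div_lt_iff_lt_mul hτ0).2 hlt
      have hdraw : drawIndex τ T s = (s : ℕ) / τ := if_pos (lt_of_lt_of_le hlt hle)
      rw [hdraw]
      split_ifs with h
      · rfl
      · rw [show (s : ℕ) / τ = n by omega]
    have h2 := mul_batchLoss_le hf hm hτ n (fun s : Fin n => W s) y
    rw [h1, mul_sub]
    linarith
  have hsum := Finset.sum_le_sum hbatch
  rw [Finset.sum_sub_distrib, Finset.sum_add_distrib, ← Finset.mul_sum, Finset.sum_const,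
    Finset.card_range, nsmul_eq_mul, ← Fin.sum_univ_eq_sum_range (fun n =>
      batchLoss f τ n (fun s => W s) (W n) - batchLoss f τ n (fun s => W s) y) J] at hsum
  have hconv : ∑ n : Fin J, (batchLoss f τ n (fun s => W s) (W n) -
        batchLoss f τ n (fun s => W s) y) =
      ∑ n : Fin J, (batchLoss f τ n
            (fun s => w (Fin.castLE hN (Fin.castLE n.isLt.le s))) (w (Fin.castLE hN n)) -
          batchLoss f τ n (fun s => w (Fin.castLE hN (Fin.castLE n.isLt.le s))) y) := by
    refine Finset.sum_congr rfl fun n _ => ?_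
    have hpre : (fun s : Fin (n : ℕ) => W s) =
        fun s => w (Fin.castLE hN (Fin.castLE n.isLt.le s)) :=
      funext fun s => hW _ (Fin.castLE hN (Fin.castLE n.isLt.le s)).isLt
    rw [hpre, hW n (Fin.castLE hN n).isLt]
    rfl
  rw [hconv] at hsum
  linarith

/-- A bound `R` on the regret of Exp3.G over the batches gives a bound on the expected policy
regret. The best constant action does not depend on the draws, so a bound against each fixed
action suffices. -/
theorem expectedPolicyRegret_le {P : Tuning V} {G : Digraph V} (h0 : 0 ≤ P.γ) (h1 : P.γ ≤ 1)
    (hU : P.U.Nonempty) (hf : UnitLosses f) (hm : HasMemory m f) (hτ : m < τ) {T : ℕ} {R : ℝ}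
    (hR : ∀ y : V,
      ∑ w : Fin (T / τ) → V, pathProb (P.drawDist G (batchLoss f τ)) (T / τ) w *
        ∑ n : Fin (T / τ), (batchLoss f τ n (fun s => w (Fin.castLE n.isLt.le s)) (w n) -
          batchLoss f τ n (fun s => w (Fin.castLE n.isLt.le s)) y) ≤ R) :
    expectedPolicyRegret P G τ T f ≤ τ * R + m * (T / τ : ℕ) + τ := by
  obtain ⟨y, hy⟩ := exists_policyRegret_playOf_le hf hm hτ T
  set D := batchDrawDist P G f τ T with hD
  have hD0 : ∀ n h x, 0 ≤ D n h x := fun n h x => P.drawDist_nonneg h0 h1 G _ _ _ x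
  have hD1 : ∀ n h, ∑ x, D n h x = 1 := fun n h => P.sum_drawDist hU G _ _ _
  have hN : T / τ ≤ numDraws τ T := Nat.le_add_right _ _
  let φ : (Fin (T / τ) → V) → ℝ := fun u =>
    ∑ n : Fin (T / τ), (batchLoss f τ n (fun s => u (Fin.castLE n.isLt.le s)) (u n) -
      batchLoss f τ n (fun s => u (Fin.castLE n.isLt.le s)) y)
  have hpoint : ∀ w : Fin (numDraws τ T) → V,
      drawProb P G f τ T w * policyRegret f T (playOf τ T w) ≤
        τ * (pathProb D (numDraws τ T) w * φ fun s => w (Fin.castLE hN s)) +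
          pathProb D (numDraws τ T) w * (m * (T / τ : ℕ) + τ) := by
    intro w
    have := mul_le_mul_of_nonneg_left (hy w) (pathProb_nonneg hD0 _ w)
    refine this.trans (le_of_eq ?_)
    simp only [φ]
    ring
  refine (Finset.sum_le_sum fun w _ => hpoint w).trans ?_
  rw [Finset.sum_add_distrib, ← Finset.mul_sum, ← Finset.sum_mul, sum_pathProb hD1,
    sum_pathProb_mul_prefix hD1 hN φ]
  have hcongr : ∀ u, pathProb D (T / τ) u =
      pathProb (P.drawDist G (batchLoss f τ)) (T / τ) u :=
    pathProb_congr fun n hn => batchDrawDist_of_le P G f hn.le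
  simp_rw [hcongr]
  have := mul_le_mul_of_nonneg_left (hR y) (Nat.cast_nonneg τ : (0 : ℝ) ≤ τ)
  linarith

end Batches

/-! ### Choice of the batch size -/

section BatchSize

/-- With batches of size of order `T ^ b`, a regret of order `J ^ a` over `J = ⌊T / τ⌋`
batches and a loss of `m` per batch add up to order `T ^ e`, as soon as `e` is at least each
of the exponents `a + b (1 - a)`, `1 - b` and `b` of the three contributions. -/
theorem exists_batch_bound_le {τ : ℕ → ℕ} {a b e A : ℝ} (m : ℕ) (hτ0 : ∀ T, 0 < τ T)
    (hτ : (fun T : ℕ => (τ T : ℝ)) =Θ[atTop] fun T : ℕ => (T : ℝ) ^ b)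
    (ha0 : 0 ≤ a) (ha1 : a ≤ 1) (hA : 0 ≤ A) (h1 : a + b * (1 - a) ≤ e) (h2 : 1 - b ≤ e)
    (h3 : b ≤ e) :
    ∃ C : ℝ, ∀ T : ℕ, 1 ≤ T →
      τ T * (A * ((T / τ T : ℕ) : ℝ) ^ a) + m * (T / τ T : ℕ) + τ T ≤ C * (T : ℝ) ^ e := by
  obtain ⟨c₂, hc₂, hup⟩ := bound_of_isBigO_nat_atTop hτ.1
  obtain ⟨c₁, hc₁, hlow⟩ := bound_of_isBigO_nat_atTop hτ.2
  refine ⟨A * c₂ ^ (1 - a) + m * c₁ + c₂, fun T hT => ?_⟩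
  have hT1 : (1 : ℝ) ≤ T := by exact_mod_cast hT
  have hT0 : (0 : ℝ) < T := by linarith
  have hτT : (0 : ℝ) < τ T := by exact_mod_cast hτ0 T
  have hpow : 0 < (T : ℝ) ^ b := Real.rpow_pos_of_pos hT0 b
  have hup' : (τ T : ℝ) ≤ c₂ * (T : ℝ) ^ b := by
    simpa [abs_of_pos hpow] using hup (x := T) hpow.ne'
  have hlow' : (T : ℝ) ^ b ≤ c₁ * τ T := by
    simpa [abs_of_pos hpow] using hlow (x := T) hτT.ne'
  have hJ : ((T / τ T : ℕ) : ℝ) ≤ T / τ T := Nat.cast_div_le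
  have mono : ∀ {r : ℝ}, r ≤ e → (T : ℝ) ^ r ≤ (T : ℝ) ^ e :=
    fun hr => Real.rpow_le_rpow_of_exponent_le hT1 hr
  have t1 : τ T * (A * ((T / τ T : ℕ) : ℝ) ^ a) ≤ A * c₂ ^ (1 - a) * (T : ℝ) ^ e := by
    calc τ T * (A * ((T / τ T : ℕ) : ℝ) ^ a)
        ≤ τ T * (A * ((T : ℝ) / τ T) ^ a) := by gcongr
      _ = A * ((T : ℝ) ^ a * (τ T : ℝ) ^ (1 - a)) := by
        rw [Real.div_rpow hT0.le hτT.le, Real.rpow_sub hτT, Real.rpow_one]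
        ring
      _ ≤ A * ((T : ℝ) ^ a * (c₂ * (T : ℝ) ^ b) ^ (1 - a)) := by
        have : 0 ≤ 1 - a := by linarith
        gcongr
      _ = A * c₂ ^ (1 - a) * (T : ℝ) ^ (a + b * (1 - a)) := by
        rw [Real.mul_rpow hc₂.le hpow.le, ← Real.rpow_mul hT0.le, Real.rpow_add hT0]
        ring
      _ ≤ _ := mul_le_mul_of_nonneg_left (mono h1) (by positivity)
  have t2 : m * ((T / τ T : ℕ) : ℝ) ≤ m * c₁ * (T : ℝ) ^ e := by
    rw [mul_assoc]
    refine mul_le_mul_of_nonneg_left (hJ.trans ?_) (by positivity)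
    calc (T : ℝ) / τ T ≤ c₁ * (T : ℝ) ^ (1 - b) := by
          rw [div_le_iff₀ hτT, Real.rpow_sub hT0, Real.rpow_one,
            show c₁ * ((T : ℝ) / (T : ℝ) ^ b) * τ T = T * ((c₁ * τ T) / (T : ℝ) ^ b) by ring]
          exact le_mul_of_one_le_right hT0.le ((one_le_div hpow).2 hlow')
      _ ≤ _ := mul_le_mul_of_nonneg_left (mono h2) hc₁.le
  have t3 : (τ T : ℝ) ≤ c₂ * (T : ℝ) ^ e :=
    hup'.trans (mul_le_mul_of_nonneg_left (mono h3) hc₂.le)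
  linarith

end BatchSize

end FeedbackGame

theorem theorem2 {V : Type*} [Fintype V] [Nonempty V] (G : Digraph V) (m : ℕ)
    (τ : ℕ → ℕ) (hτ : ∀ T, m < τ T) :
    (FeedbackGame.StronglyObservable G →
      (fun T : ℕ => (τ T : ℝ)) =Θ[atTop] (fun T : ℕ => (T : ℝ) ^ (1 / 3 : ℝ)) →
      ∃ (C : ℝ) (k : ℕ), ∀ T : ℕ, 2 ≤ T → ∀ f : FeedbackGame.LossSeq V,
        FeedbackGame.UnitLosses f → FeedbackGame.HasMemory m f →
          FeedbackGame.expectedPolicyRegret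
              (FeedbackGame.strongTuning G (T / τ T)) G (τ T) T f
            ≤ C * (T : ℝ) ^ (2 / 3 : ℝ) * Real.log T ^ k) ∧
    (FeedbackGame.WeaklyObservable G →
      (fun T : ℕ => (τ T : ℝ)) =Θ[atTop] (fun T : ℕ => (T : ℝ) ^ (1 / 4 : ℝ)) →
      (∃ U : Finset V, FeedbackGame.WeaklyDominating G U ∧ ∀ d, U = {d} → G.Adj d d) ∧
      ∀ U : Finset V, FeedbackGame.WeaklyDominating G U → (∀ d, U = {d} → G.Adj d d) →
        ∃ (C : ℝ) (k : ℕ), ∀ T : ℕ, 2 ≤ T → ∀ f : FeedbackGame.LossSeq V,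
          FeedbackGame.UnitLosses f → FeedbackGame.HasMemory m f →
            FeedbackGame.expectedPolicyRegret
                (FeedbackGame.weakTuning U (T / τ T)) G (τ T) T f
              ≤ C * (T : ℝ) ^ (3 / 4 : ℝ) * Real.log T ^ k) := by
  have hτ0 : ∀ T, 0 < τ T := fun T => (Nat.zero_le m).trans_lt (hτ T)
  refine ⟨fun hG hΘ => ?_, fun hG hΘ => ⟨⟨Finset.univ, FeedbackGame.weaklyDominating_univ G, ?_⟩, ?_⟩⟩
  · obtain ⟨A, hA, hreg⟩ := FeedbackGame.exists_strongTuning_regret_le hG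
    obtain ⟨C, hC⟩ := FeedbackGame.exists_batch_bound_le (a := 1 / 2) (e := 2 / 3) m hτ0 hΘ
      (by norm_num) (by norm_num) hA (by norm_num) (by norm_num) (by norm_num)
    -- As the constants may depend on `G`, no logarithmic factor is needed: `k = 0`.
    refine ⟨C, 0, fun T hT f hf hm => ?_⟩
    rw [pow_zero, mul_one]
    refine le_trans ?_ (hC T (by omega))
    refine FeedbackGame.expectedPolicyRegret_le (le_min (by positivity) (by norm_num))
      ((min_le_right _ _).trans (by norm_num)) Finset.univ_nonempty hf hm (hτ T) fun y => ?_
    exact hreg _ _ (FeedbackGame.batchLoss_mem_Icc hf (hτ0 T)) y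
  · intro d hd
    have := hG.nontrivial
    obtain ⟨v, hv⟩ := exists_ne d
    exact absurd (Finset.mem_singleton.1 (hd ▸ Finset.mem_univ v)) hv
  · intro U hU hU1
    have hUne := hG.nonempty_of_weaklyDominating hU
    obtain ⟨A, hA, hreg⟩ := FeedbackGame.exists_weakTuning_regret_le hG hU hU1
    obtain ⟨C, hC⟩ := FeedbackGame.exists_batch_bound_le (a := 2 / 3) (e := 3 / 4) m hτ0 hΘ
      (by norm_num) (by norm_num) hA (by norm_num) (by norm_num) (by norm_num)
    refine ⟨C, 0, fun T hT f hf hm => ?_⟩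
    rw [pow_zero, mul_one]
    refine le_trans ?_ (hC T (by omega))
    refine FeedbackGame.expectedPolicyRegret_le
      (le_min (Real.rpow_nonneg (div_nonneg (mul_nonneg (Nat.cast_nonneg _)
        (Real.log_natCast_nonneg _)) (Nat.cast_nonneg _)) _) (by norm_num))
      ((min_le_right _ _).trans (by norm_num)) hUne hf hm (hτ T) fun y => ?_
    exact hreg _ _ (FeedbackGame.batchLoss_mem_Icc hf (hτ0 T)) y
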